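/- The logic MTL has formulas built from denumerably many propositional variables with the connectives $\&,\wedge,\to$ (binary) and $\bot$ (nullary), the axioms (for all formulas $\varphi,\psi,\chi$) $(\varphi\to\psi)\to((\psi\to\chi)\to(\varphi\to\chi))$, $(\varphi\&\psi)\to\varphi$, $(\varphi\&\psi)\to(\psi\&\varphi)$, $(\varphi\wedge\psi)\to\varphi$, $(\varphi\wedge\psi)\to(\psi\wedge\varphi)$, $(\varphi\&(\varphi\to\psi))\to(\psi\wedge\varphi)$, $(\varphi\to(\psi\to\chi))\to((\varphi\&\psi)\to\chi)$, $((\varphi\&\psi)\to\chi)\to(\varphi\to(\psi\to\chi))$, $((\varphi\to\psi)\to\chi)\to(((\psi\to\varphi)\to\chi)\to\chi)$, $\bot\to\varphi$, and modus ponens as its only rule. An axiomatic extension $L$ of MTL is obtained by adding a set of axiom schemes (closed under substitution). Put $\varphi^1=\varphi$, $\varphi^{k+1}=\varphi^k\&\varphi$; for $n\ge 1$, $L$ is called $n$-contractive if $\vdash_L\varphi^n\to\varphi^{n+1}$ for every formula $\varphi$. An MTL-algebra is an algebra $\langle A,*,\Rightarrow,\sqcap,\sqcup,0,1\rangle$ such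 that $\langle A,\sqcap,\sqcup,0,1\rangle$ is a lattice with minimum $0$ and maximum $1$, $\langle A,*,1\rangle$ is a commutative monoid, $z*x\le y$ iff $z\le x\Rightarrow y$, and $(x\Rightarrow y)\sqcup(y\Rightarrow x)=1$ for all $x,y,z\in A$. A formula is valid in $A$ if it takes the value $1$ under every assignment of its variables in $A$, where $\&,\wedge,\to,\bot$ are interpreted by $*,\sqcap,\Rightarrow,0$. An $L$-algebra is an MTL-algebra in which all the additional axioms of $L$ are valid; an $L$-chain is a totally ordered $L$-algebra. **Theorem.** Let $n\ge 1$ and let $L$ be an $n$-contractive axiomatic extension of MTL. The following are equivalent. 1. $L$ enjoys the single chain completeness (SCC): there is an $L$-chain $A$ such that $L$ is complete with respect to $A$, i.e. for every formula $\varphi$, $\vdash_L\varphi$ if and only if $\varphi$ is valid in $A$. 2. $L$ enjoys the subdirect single chain completeness (subSCC): there is a subdirectly irreducible $L$-algebra that is generic, i.e. generates the variety of all $L$-algebras. Here an algebra is subdirectly irreducible if it is trivial or has a least congruence among those different from the identity. -/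

import Mathlib

universe u v

namespace MTL

/-! ### Syntax -/

/-- Formulas over the connectives `&`, `∧`, `→`, `⊥` and denumerably many variables. -/
inductive Formula : Type
  | var : ℕ → Formula
  | bot : Formula
  | conj : Formula → Formula → Formula
  | meet : Formula → Formula → Formula
  | imp : Formula → Formula → Formula

namespace Formula

/-- Truth constant `⊥ → ⊥`, used only as the zeroth power. -/
def top : Formula := imp bot bot

/-- Powers with respect to the strong conjunction: `φ¹ = φ`, `φᵏ⁺¹ = φᵏ & φ`. -/
def pow (φ : Formula) : ℕ → Formula
  | 0 => top
  | 1 => φ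
  | k + 2 => conj (pow φ (k + 1)) φ

/-- Simultaneous substitution of formulas for variables. -/
def subst (σ : ℕ → Formula) : Formula → Formula
  | var i => σ i
  | bot => bot
  | conj φ ψ => conj (subst σ φ) (subst σ ψ)
  | meet φ ψ => meet (subst σ φ) (subst σ ψ)
  | imp φ ψ => imp (subst σ φ) (subst σ ψ)

end Formula

open Formula in
/-- The axioms of MTL (all instances). -/
inductive BaseRule : Formula → Prop
  | a1 (φ ψ χ : Formula) : BaseRule (imp (imp φ ψ) (imp (imp ψ χ) (imp φ χ)))
  | a2 (φ ψ : Formula) : BaseRule (imp (conj φ ψ) φ)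
  | a3 (φ ψ : Formula) : BaseRule (imp (conj φ ψ) (conj ψ φ))
  | a4 (φ ψ : Formula) : BaseRule (imp (meet φ ψ) φ)
  | a5 (φ ψ : Formula) : BaseRule (imp (meet φ ψ) (meet ψ φ))
  | a6 (φ ψ : Formula) : BaseRule (imp (conj φ (imp φ ψ)) (meet ψ φ))
  | a7a (φ ψ χ : Formula) : BaseRule (imp (imp φ (imp ψ χ)) (imp (conj φ ψ) χ))
  | a7b (φ ψ χ : Formula) : BaseRule (imp (imp (conj φ ψ) χ) (imp φ (imp ψ χ)))
  | a8 (φ ψ χ : Formula) :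
      BaseRule (imp (imp (imp φ ψ) χ) (imp (imp (imp ψ φ) χ) χ))
  | a9 (φ : Formula) : BaseRule (imp bot φ)

/-- An axiomatic extension of MTL, presented by the set of its additional axiom schemes
(the formulas in `schemes` and all their substitution instances are the new axioms). -/
structure Extension : Type where
  schemes : Set Formula

/-- `Derives L Γ φ`: there is a proof of `φ` from the theory `Γ` in `L`. -/
inductive Derives (L : Extension) (Γ : Set Formula) : Formula → Prop
  | hyp {φ : Formula} : φ ∈ Γ → Derives L Γ φ
  | base {φ : Formula} : BaseRule φ → Derives L Γ φ
  | scheme {φ : Formula} (σ : ℕ → Formula) : φ ∈ L.schemes → Derives L Γ (φ.subst σ)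
  | mp {φ ψ : Formula} : Derives L Γ φ → Derives L Γ (Formula.imp φ ψ) → Derives L Γ ψ

/-- `φ` is a theorem of `L`. -/
def Provable (L : Extension) (φ : Formula) : Prop := Derives L ∅ φ

/-- `L` proves `φⁿ → φⁿ⁺¹` for every formula `φ`. -/
def Contractive (L : Extension) (n : ℕ) : Prop :=
  ∀ φ : Formula, Provable L (Formula.imp (φ.pow n) (φ.pow (n + 1)))

/-! ### Semantics -/

/-- FL_ew-algebras: bounded lattices (with `⊤ = 1`) that are commutative monoids, with a residual
`⇨` of the monoid operation. -/
class FLewAlgebra (A : Type u) extends Lattice A, BoundedOrder A, CommMonoid A, HImp A where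
  top_eq_one : (⊤ : A) = 1
  residuation : ∀ x y z : A, z * x ≤ y ↔ z ≤ x ⇨ y

/-- MTL-algebras: prelinear FL_ew-algebras. -/
class MTLAlgebra (A : Type u) extends FLewAlgebra A where
  prelinearity : ∀ x y : A, (x ⇨ y) ⊔ (y ⇨ x) = 1

/-- The value of a formula under an assignment of its variables. -/
def eval {A : Type u} [MTLAlgebra A] (e : ℕ → A) : Formula → A
  | .var i => e i
  | .bot => ⊥
  | .conj φ ψ => eval e φ * eval e ψ
  | .meet φ ψ => eval e φ ⊓ eval e ψ
  | .imp φ ψ => eval e φ ⇨ eval e ψ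

/-- `φ` is valid in `A`. -/
def Valid (A : Type u) [MTLAlgebra A] (φ : Formula) : Prop :=
  ∀ e : ℕ → A, eval e φ = 1

/-- The identity `φ ≈ ψ` holds in `A`. Since `⊔` and `1` are term-definable from the other
operations in MTL-algebras, formulas represent all terms in the signature of MTL-algebras. -/
def SatisfiesIdentity (A : Type u) [MTLAlgebra A] (φ ψ : Formula) : Prop :=
  ∀ e : ℕ → A, eval e φ = eval e ψ

/-- `A` belongs to the variety corresponding to `L`. -/
def IsAlgebraOf (L : Extension) (A : Type u) [MTLAlgebra A] : Prop :=
  ∀ φ ∈ L.schemes, Valid A φ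

/-- `A` is totally ordered. -/
def IsChain (A : Type u) [MTLAlgebra A] : Prop :=
  ∀ x y : A, x ≤ y ∨ y ≤ x

/-- `L` is complete with respect to `A`. -/
def CompleteWrt (L : Extension) (A : Type u) [MTLAlgebra A] : Prop :=
  ∀ φ : Formula, Provable L φ ↔ Valid A φ

/-- `B` belongs to the variety (equational class) generated by `A`: it satisfies all the
identities of `A`. -/
def InVarietyGeneratedBy (A : Type u) [MTLAlgebra A] (B : Type u) [MTLAlgebra B] : Prop :=
  ∀ φ ψ : Formula, SatisfiesIdentity A φ ψ → SatisfiesIdentity B φ ψ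

/-- `A` is generic for `L`: the variety generated by `A` is the variety of all `L`-algebras. -/
def IsGeneric (L : Extension) (A : Type u) [MTLAlgebra A] : Prop :=
  ∀ (B : Type u) [MTLAlgebra B], InVarietyGeneratedBy A B ↔ IsAlgebraOf L B

/-- Congruences of an MTL-algebra: equivalence relations compatible with all operations. -/
structure Congruence (A : Type u) [MTLAlgebra A] extends Setoid A where
  mul : ∀ {a b c d : A}, r a b → r c d → r (a * c) (b * d)
  himp : ∀ {a b c d : A}, r a b → r c d → r (a ⇨ c) (b ⇨ d)
  inf : ∀ {a b c d : A}, r a b → r c d → r (a ⊓ c) (b ⊓ d)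
  sup : ∀ {a b c d : A}, r a b → r c d → r (a ⊔ c) (b ⊔ d)

/-- The congruence differs from the identity relation. -/
def Congruence.Nontrivial {A : Type u} [MTLAlgebra A] (θ : Congruence A) : Prop :=
  ∃ x y : A, θ.r x y ∧ x ≠ y

/-- `A` is subdirectly irreducible: it is trivial or has a least congruence among those different
from the identity. (The trivial algebra matters for the inconsistent logic only, since it is not
generic for any other one.) -/
def SubdirectlyIrreducible (A : Type u) [MTLAlgebra A] : Prop :=
  Subsingleton A ∨
    ∃ μ : Congruence A, μ.Nontrivial ∧
      ∀ θ : Congruence A, θ.Nontrivial → ∀ x y : A, μ.r x y → θ.r x y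

/-- Single chain completeness: `L` is complete with respect to some `L`-chain. -/
def SCC (L : Extension) : Prop :=
  ∃ (A : Type u) (_ : MTLAlgebra A), IsAlgebraOf L A ∧ IsChain A ∧ CompleteWrt L A

/-- Subdirect single chain completeness: there is a generic subdirectly irreducible
`L`-algebra. -/
def SubSCC (L : Extension) : Prop :=
  ∃ (A : Type u) (_ : MTLAlgebra A),
    IsAlgebraOf L A ∧ SubdirectlyIrreducible A ∧ IsGeneric L A

end MTL

/-!
An algebra is generic for `L` exactly when `L` is complete with respect to it, so the theorem is
about passing between complete chains and complete subdirectly irreducible algebras.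

If `x ⇨ y` and `y ⇨ x` both differ from `1`, then the filters they generate are nontrivial, but
they meet in `{1}` because powers of two elements with join `1` again have join `1`. Hence a
subdirectly irreducible algebra is a chain.

Conversely, let `L` be complete with respect to a nontrivial chain `A`. Give every formula `φ` a
copy `φ*` in variables of its own, keep one more variable `p` apart, and consider the theory of all
`φ* → p` with `φ` unprovable. It does not derive `p`: finitely many unprovable formulas are refuted
in `A` by a single assignment, which may send `p` to the largest of their values. In the Lindenbaum
algebra of a maximal extension of this theory that does not derive `p`, the class of `p` generates
the monolith, and every unprovable formula is refuted.
-/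

namespace MTL

open Formula

/-! ### Residuation and filters -/

section FLewAlgebra

variable {A : Type u} [FLewAlgebra A] {a b c d : A}

theorem le_one (a : A) : a ≤ 1 :=
  FLewAlgebra.top_eq_one (A := A) ▸ le_top

theorem bot_ne_one [Nontrivial A] : (⊥ : A) ≠ 1 :=
  FLewAlgebra.top_eq_one (A := A) ▸ bot_ne_top

theorem le_himp_iff_mul_le : a ≤ b ⇨ c ↔ a * b ≤ c :=
  (FLewAlgebra.residuation b c a).symm

theorem himp_mul_le (a b : A) : (a ⇨ b) * a ≤ b :=
  le_himp_iff_mul_le.1 le_rfl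

theorem himp_eq_one_iff : a ⇨ b = 1 ↔ a ≤ b := by
  rw [← (le_one (a ⇨ b)).ge_iff_eq, le_himp_iff_mul_le, one_mul]

theorem himp_self_eq_one (a : A) : a ⇨ a = 1 :=
  himp_eq_one_iff.2 le_rfl

theorem exists_himp_ne_one_of_ne (h : a ≠ b) : a ⇨ b ≠ 1 ∨ b ⇨ a ≠ 1 := by
  simp only [ne_eq, himp_eq_one_iff, ← not_and_or]
  exact fun hab => h (le_antisymm hab.1 hab.2)

theorem one_himp (a : A) : 1 ⇨ a = a :=
  le_antisymm (by simpa only [mul_one] using himp_mul_le 1 a)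
    (le_himp_iff_mul_le.2 (mul_one a).le)

instance : IsOrderedMonoid A where
  mul_le_mul_left _ _ h _ := le_himp_iff_mul_le.1 (h.trans (le_himp_iff_mul_le.2 le_rfl))

theorem mul_le_left (a b : A) : a * b ≤ a :=
  mul_le_of_le_one_right' (le_one b)

theorem mul_le_right (a b : A) : a * b ≤ b :=
  mul_le_of_le_one_left' (le_one a)

theorem sup_mul_le_iff : (a ⊔ b) * c ≤ d ↔ a * c ≤ d ∧ b * c ≤ d := by
  simp only [← le_himp_iff_mul_le, sup_le_iff]

theorem mul_sup_le_iff : a * (b ⊔ c) ≤ d ↔ a * b ≤ d ∧ a * c ≤ d := by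
  simp only [mul_comm a, sup_mul_le_iff]

theorem sup_mul_eq_one (hb : a ⊔ b = 1) (hc : a ⊔ c = 1) : a ⊔ b * c = 1 := by
  refine le_antisymm (le_one _) ?_
  calc
    1 = (a ⊔ b) * (a ⊔ c) := by rw [hb, hc, one_mul]
    _ ≤ a ⊔ b * c := sup_mul_le_iff.2
      ⟨(mul_le_left _ _).trans le_sup_left,
        mul_sup_le_iff.2 ⟨(mul_le_right _ _).trans le_sup_left, le_sup_right⟩⟩

theorem sup_pow_eq_one (h : a ⊔ b = 1) (k : ℕ) : a ⊔ b ^ k = 1 := by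
  induction k with
  | zero => rw [pow_zero, sup_eq_right.2 (le_one a)]
  | succ k ih => rw [pow_succ, sup_mul_eq_one ih h]

theorem pow_sup_pow_eq_one (h : a ⊔ b = 1) (k m : ℕ) : a ^ k ⊔ b ^ m = 1 := by
  rw [sup_comm] at h ⊢
  exact sup_pow_eq_one (sup_comm a _ ▸ sup_pow_eq_one (sup_comm b a ▸ h) m) k

theorem himp_mul_himp_le_himp (a b c : A) : (a ⇨ b) * (b ⇨ c) ≤ a ⇨ c := by
  rw [le_himp_iff_mul_le, mul_right_comm]
  exact (mul_le_mul_left (himp_mul_le a b) _).trans (mul_comm b _ ▸ himp_mul_le b c)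

theorem himp_mul_himp_le_mul_himp_mul (a b c d : A) : (a ⇨ b) * (c ⇨ d) ≤ a * c ⇨ b * d := by
  rw [le_himp_iff_mul_le, mul_mul_mul_comm]
  exact mul_le_mul' (himp_mul_le a b) (himp_mul_le c d)

theorem himp_mul_himp_le_himp_himp_himp (a b c d : A) :
    (b ⇨ a) * (c ⇨ d) ≤ (a ⇨ c) ⇨ (b ⇨ d) := by
  rw [le_himp_iff_mul_le, mul_right_comm]
  exact (mul_le_mul_left (himp_mul_himp_le_himp b a c) _).trans (himp_mul_himp_le_himp b c d)

theorem himp_mul_himp_le_inf_himp_inf (a b c d : A) : (a ⇨ b) * (c ⇨ d) ≤ a ⊓ c ⇨ b ⊓ d := by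
  rw [le_himp_iff_mul_le]
  exact le_inf
    ((mul_le_mul' (mul_le_left _ _) inf_le_left).trans (himp_mul_le a b))
    ((mul_le_mul' (mul_le_right _ _) inf_le_right).trans (himp_mul_le c d))

theorem himp_mul_himp_le_sup_himp_sup (a b c d : A) : (a ⇨ b) * (c ⇨ d) ≤ a ⊔ c ⇨ b ⊔ d := by
  rw [le_himp_iff_mul_le, mul_sup_le_iff]
  exact ⟨(mul_le_mul_left (mul_le_left _ _) a).trans ((himp_mul_le a b).trans le_sup_left),
    (mul_le_mul_left (mul_le_right _ _) c).trans ((himp_mul_le c d).trans le_sup_right)⟩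

/-- The filter generated by `a`, as a submonoid: all elements above some power of `a`. -/
def principalFilter (a : A) : Submonoid A where
  carrier := {x | ∃ k : ℕ, a ^ k ≤ x}
  one_mem' := ⟨0, (pow_zero a).le⟩
  mul_mem' := by
    rintro x y ⟨k, hk⟩ ⟨m, hm⟩
    exact ⟨k + m, pow_add a k m ▸ mul_le_mul' hk hm⟩

theorem isUpperSet_principalFilter (a : A) : IsUpperSet (principalFilter a : Set A) :=
  fun _ _ hxy ⟨k, hk⟩ => ⟨k, hk.trans hxy⟩

theorem mem_principalFilter_self (a : A) : a ∈ principalFilter a :=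
  ⟨1, (pow_one a).le⟩

end FLewAlgebra

section Congruence

variable {A : Type u} [MTLAlgebra A]

/-- The congruence whose class of `1` is the filter `F`; filters are encoded as submonoids that are
upper sets. -/
def filterCongruence (F : Submonoid A) (hF : IsUpperSet (F : Set A)) : Congruence A where
  r x y := x ⇨ y ∈ F ∧ y ⇨ x ∈ F
  iseqv :=
    ⟨fun x => by simp only [himp_self_eq_one, F.one_mem, and_self], And.symm, fun h h' =>
      ⟨hF (himp_mul_himp_le_himp _ _ _) (F.mul_mem h.1 h'.1),
        hF (himp_mul_himp_le_himp _ _ _) (F.mul_mem h'.2 h.2)⟩⟩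
  mul h h' :=
    ⟨hF (himp_mul_himp_le_mul_himp_mul _ _ _ _) (F.mul_mem h.1 h'.1),
      hF (himp_mul_himp_le_mul_himp_mul _ _ _ _) (F.mul_mem h.2 h'.2)⟩
  himp h h' :=
    ⟨hF (himp_mul_himp_le_himp_himp_himp _ _ _ _) (F.mul_mem h.2 h'.1),
      hF (himp_mul_himp_le_himp_himp_himp _ _ _ _) (F.mul_mem h.1 h'.2)⟩
  inf h h' :=
    ⟨hF (himp_mul_himp_le_inf_himp_inf _ _ _ _) (F.mul_mem h.1 h'.1),
      hF (himp_mul_himp_le_inf_himp_inf _ _ _ _) (F.mul_mem h.2 h'.2)⟩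
  sup h h' :=
    ⟨hF (himp_mul_himp_le_sup_himp_sup _ _ _ _) (F.mul_mem h.1 h'.1),
      hF (himp_mul_himp_le_sup_himp_sup _ _ _ _) (F.mul_mem h.2 h'.2)⟩

theorem filterCongruence_nontrivial {F : Submonoid A} {hF : IsUpperSet (F : Set A)} {a : A}
    (haF : a ∈ F) (ha : a ≠ 1) : (filterCongruence F hF).Nontrivial :=
  ⟨a, 1, ⟨by rw [himp_eq_one_iff.2 (le_one a)]; exact F.one_mem, by rwa [one_himp]⟩, ha⟩

theorem Congruence.rel_one_of_rel_himp_one (θ : Congruence A) {a b : A} (ha : θ.r a 1)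
    (hab : θ.r (a ⇨ b) 1) : θ.r b 1 := by
  have h := θ.himp ha (θ.iseqv.refl b)
  rw [one_himp] at h
  exact θ.iseqv.trans (θ.iseqv.symm h) hab

theorem Congruence.rel_himp_one (θ : Congruence A) {a b : A} (h : θ.r a b) : θ.r (a ⇨ b) 1 :=
  himp_self_eq_one b ▸ θ.himp h (θ.iseqv.refl b)

theorem Congruence.Nontrivial.exists_rel_one {θ : Congruence A} (hθ : θ.Nontrivial) :
    ∃ z : A, z ≠ 1 ∧ θ.r z 1 := by
  obtain ⟨x, y, hxy, hne⟩ := hθ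
  rcases exists_himp_ne_one_of_ne hne with h | h
  · exact ⟨x ⇨ y, h, θ.rel_himp_one hxy⟩
  · exact ⟨y ⇨ x, h, θ.rel_himp_one (θ.iseqv.symm hxy)⟩

variable (A) in
/-- The intersection of all congruences different from the identity. It is the least of them when
`A` is nontrivial and subdirectly irreducible, and the identity otherwise. -/
def monolith : Congruence A where
  r x y := ∀ θ : Congruence A, θ.Nontrivial → θ.r x y
  iseqv := ⟨fun x θ _ => θ.iseqv.refl x, fun h θ hθ => θ.iseqv.symm (h θ hθ),
    fun h h' θ hθ => θ.iseqv.trans (h θ hθ) (h' θ hθ)⟩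
  mul h h' θ hθ := θ.mul (h θ hθ) (h' θ hθ)
  himp h h' θ hθ := θ.himp (h θ hθ) (h' θ hθ)
  inf h h' θ hθ := θ.inf (h θ hθ) (h' θ hθ)
  sup h h' θ hθ := θ.sup (h θ hθ) (h' θ hθ)

theorem SubdirectlyIrreducible.of_forall_rel_one {a : A} (ha : a ≠ 1)
    (h : ∀ θ : Congruence A, θ.Nontrivial → θ.r a 1) : SubdirectlyIrreducible A :=
  Or.inr ⟨monolith A, ⟨a, 1, h, ha⟩, fun θ hθ _ _ hxy => hxy θ hθ⟩

theorem SubdirectlyIrreducible.exists_forall_pow_le [Nontrivial A]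
    (hA : SubdirectlyIrreducible A) : ∃ z : A, z ≠ 1 ∧ ∀ a : A, a ≠ 1 → ∃ k : ℕ, a ^ k ≤ z := by
  obtain ⟨μ, hμ, hleast⟩ := hA.resolve_left (not_subsingleton A)
  obtain ⟨z, hz, hz1⟩ := hμ.exists_rel_one
  refine ⟨z, hz, fun a ha => ?_⟩
  have hmem := (hleast (filterCongruence _ (isUpperSet_principalFilter a))
    (filterCongruence_nontrivial (mem_principalFilter_self a) ha) z 1 hz1).2
  rwa [one_himp] at hmem

theorem SubdirectlyIrreducible.isChain (hA : SubdirectlyIrreducible A) : IsChain A := by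
  intro x y
  rcases subsingleton_or_nontrivial A with _ | _
  · exact Or.inl (Subsingleton.elim x y).le
  obtain ⟨z, hz, hle⟩ := hA.exists_forall_pow_le
  simp only [← himp_eq_one_iff]
  by_contra! hxy
  obtain ⟨k, hk⟩ := hle _ hxy.1
  obtain ⟨m, hm⟩ := hle _ hxy.2
  have hone : (x ⇨ y) ^ k ⊔ (y ⇨ x) ^ m = 1 :=
    pow_sup_pow_eq_one (MTLAlgebra.prelinearity x y) k m
  exact hz (le_antisymm (le_one z) (hone ▸ sup_le hk hm))

theorem IsChain.finset_sup_ne_one [Nontrivial A] (hA : IsChain A) {ι : Type*} {s : Finset ι}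
    {f : ι → A} (hf : ∀ i ∈ s, f i ≠ 1) : s.sup f ≠ 1 := by
  refine Finset.sup_induction (p := (· ≠ 1)) bot_ne_one (fun a ha b hb => ?_) hf
  rcases hA a b with hab | hba
  · rwa [sup_eq_right.2 hab]
  · rwa [sup_eq_left.2 hba]

end Congruence

/-! ### Soundness -/

section Soundness

variable {A : Type u} [MTLAlgebra A] {L : Extension} {Γ : Set Formula} {φ : Formula}

theorem eval_top (e : ℕ → A) : eval e Formula.top = 1 :=
  himp_self_eq_one _

theorem eval_subst (e : ℕ → A) (σ : ℕ → Formula) (φ : Formula) :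
    eval e (φ.subst σ) = eval (fun i => eval e (σ i)) φ := by
  induction φ with
  | var i => rfl
  | bot => rfl
  | conj φ ψ h h' => simp only [subst, eval, h, h']
  | meet φ ψ h h' => simp only [subst, eval, h, h']
  | imp φ ψ h h' => simp only [subst, eval, h, h']

theorem BaseRule.valid (h : BaseRule φ) : Valid A φ := by
  intro e
  cases h with
  | a1 φ ψ χ => exact himp_eq_one_iff.2 (le_himp_iff_mul_le.2 (himp_mul_himp_le_himp _ _ _))
  | a2 φ ψ => exact himp_eq_one_iff.2 (mul_le_left _ _)
  | a3 φ ψ => exact himp_eq_one_iff.2 (mul_comm _ _).le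
  | a4 φ ψ => exact himp_eq_one_iff.2 inf_le_left
  | a5 φ ψ => exact himp_eq_one_iff.2 (inf_comm (eval e φ) (eval e ψ)).le
  | a6 φ ψ =>
    exact himp_eq_one_iff.2 (le_inf ((mul_comm _ _).trans_le (himp_mul_le _ _)) (mul_le_left _ _))
  | a7a φ ψ χ =>
    simp only [eval, himp_eq_one_iff, le_himp_iff_mul_le, ← mul_assoc]
    exact (mul_le_mul_left (himp_mul_le _ _) _).trans (himp_mul_le _ _)
  | a7b φ ψ χ =>
    simp only [eval, himp_eq_one_iff, le_himp_iff_mul_le, mul_assoc]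
    exact himp_mul_le _ _
  | a8 φ ψ χ =>
    simp only [eval, himp_eq_one_iff, le_himp_iff_mul_le]
    set a := eval e φ
    set b := eval e ψ
    set c := eval e χ
    set d := ((a ⇨ b) ⇨ c) * ((b ⇨ a) ⇨ c)
    calc
      d = d * ((a ⇨ b) ⊔ (b ⇨ a)) := by rw [MTLAlgebra.prelinearity, mul_one]
      _ ≤ c := mul_sup_le_iff.2
        ⟨(mul_le_mul_left (mul_le_left _ _) _).trans (himp_mul_le _ _),
          (mul_le_mul_left (mul_le_right _ _) _).trans (himp_mul_le _ _)⟩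
  | a9 φ => exact himp_eq_one_iff.2 bot_le

theorem Derives.eval_eq_one (hA : IsAlgebraOf L A) {e : ℕ → A} (hΓ : ∀ ψ ∈ Γ, eval e ψ = 1)
    (h : Derives L Γ φ) : eval e φ = 1 := by
  induction h with
  | hyp h => exact hΓ _ h
  | base h => exact h.valid e
  | scheme σ h => rw [eval_subst, hA _ h]
  | mp _ _ h h' => rwa [eval, h, one_himp] at h'

theorem Provable.valid (h : Provable L φ) (hA : IsAlgebraOf L A) : Valid A φ :=
  fun _ => Derives.eval_eq_one hA (fun _ => False.elim) h

theorem IsAlgebraOf.completeWrt (hA : IsAlgebraOf L A) (h : ∀ φ, Valid A φ → Provable L φ) :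
    CompleteWrt L A :=
  fun φ => ⟨fun hφ => hφ.valid hA, h φ⟩

theorem subst_var (φ : Formula) : φ.subst var = φ := by
  induction φ with
  | var i => rfl
  | bot => rfl
  | conj φ ψ h h' => rw [subst, h, h']
  | meet φ ψ h h' => rw [subst, h, h']
  | imp φ ψ h h' => rw [subst, h, h']

theorem CompleteWrt.isAlgebraOf (hA : CompleteWrt L A) : IsAlgebraOf L A :=
  fun φ hφ => (hA φ).1 (subst_var φ ▸ Derives.scheme var hφ)

theorem satisfiesIdentity_iff_valid_imp {ψ : Formula} :
    SatisfiesIdentity A φ ψ ↔ Valid A (imp φ ψ) ∧ Valid A (imp ψ φ) := by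
  simp only [SatisfiesIdentity, Valid, eval, himp_eq_one_iff, ← forall_and]
  exact forall_congr' fun _ => le_antisymm_iff

theorem satisfiesIdentity_top_iff : SatisfiesIdentity A φ Formula.top ↔ Valid A φ := by
  simp only [SatisfiesIdentity, Valid, eval_top]

end Soundness

/-! ### Derivations -/

namespace Derives

variable {L : Extension} {Γ Δ : Set Formula} {φ ψ χ ξ : Formula}

theorem mono (hΓ : Γ ⊆ Δ) (h : Derives L Γ φ) : Derives L Δ φ := by
  induction h with
  | hyp h => exact .hyp (hΓ h)
  | base h => exact .base h
  | scheme σ h => exact .scheme σ h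
  | mp _ _ h h' => exact .mp h h'

theorem exists_finite_subset (h : Derives L Γ φ) : ∃ S ⊆ Γ, S.Finite ∧ Derives L S φ := by
  induction h with
  | @hyp φ h => exact ⟨{φ}, Set.singleton_subset_iff.2 h, Set.finite_singleton φ, .hyp rfl⟩
  | base h => exact ⟨∅, Set.empty_subset Γ, Set.finite_empty, .base h⟩
  | scheme σ h => exact ⟨∅, Set.empty_subset Γ, Set.finite_empty, .scheme σ h⟩
  | mp _ _ ih ih' =>
    obtain ⟨S, hSΓ, hS, h⟩ := ih
    obtain ⟨T, hTΓ, hT, h'⟩ := ih'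
    exact ⟨S ∪ T, Set.union_subset hSΓ hTΓ, hS.union hT,
      .mp (h.mono Set.subset_union_left) (h'.mono Set.subset_union_right)⟩

theorem exists_maximal_not_derives (h : ¬ Derives L Γ φ) :
    ∃ Δ, Γ ⊆ Δ ∧ Maximal (fun Δ => ¬ Derives L Δ φ) Δ := by
  refine zorn_subset_nonempty {Δ | ¬ Derives L Δ φ} (fun c hcφ hc hne => ?_) Γ h
  refine ⟨⋃₀ c, fun hφ => ?_, fun _ => Set.subset_sUnion_of_mem⟩
  obtain ⟨S, hSc, hS, hSφ⟩ := hφ.exists_finite_subset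
  obtain ⟨T, hT, hST⟩ := hc.directedOn.exists_mem_subset_of_finite_of_subset_sUnion hne hS hSc
  exact hcφ hT (hSφ.mono hST)

theorem imp_trans (h : Derives L Γ (imp φ ψ)) (h' : Derives L Γ (imp ψ χ)) :
    Derives L Γ (imp φ χ) :=
  .mp h' (.mp h (.base (.a1 φ ψ χ)))

theorem conj_imp_iff : Derives L Γ (imp (conj φ ψ) χ) ↔ Derives L Γ (imp φ (imp ψ χ)) :=
  ⟨fun h => .mp h (.base (.a7b φ ψ χ)), fun h => .mp h (.base (.a7a φ ψ χ))⟩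

theorem conj_imp_left : Derives L Γ (imp (conj φ ψ) φ) :=
  .base (.a2 φ ψ)

theorem conj_imp_swap : Derives L Γ (imp (conj φ ψ) (conj ψ φ)) :=
  .base (.a3 φ ψ)

theorem exchange (h : Derives L Γ (imp φ (imp ψ χ))) : Derives L Γ (imp ψ (imp φ χ)) :=
  conj_imp_iff.1 (conj_imp_swap.imp_trans (conj_imp_iff.2 h))

theorem imp_of_derives (h : Derives L Γ φ) : Derives L Γ (imp ψ φ) :=
  .mp h (conj_imp_iff.1 conj_imp_left)

theorem bot_imp : Derives L Γ (imp bot φ) :=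
  .base (.a9 φ)

theorem imp_refl (φ : Formula) : Derives L Γ (imp φ φ) :=
  .mp (bot_imp (φ := φ)) (exchange (conj_imp_iff.1 conj_imp_left))

theorem top : Derives L Γ Formula.top :=
  imp_refl bot

theorem imp_conj_mono (h : Derives L Γ (imp φ ψ)) (h' : Derives L Γ (imp χ ξ)) :
    Derives L Γ (imp (conj φ χ) (conj ψ ξ)) := by
  have mono_left {φ ψ : Formula} (χ : Formula) (h : Derives L Γ (imp φ ψ)) :
      Derives L Γ (imp (conj φ χ) (conj ψ χ)) :=
    conj_imp_iff.2 (h.imp_trans (conj_imp_iff.1 (imp_refl _)))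
  exact (mono_left χ h).imp_trans <| conj_imp_swap.imp_trans <|
    (mono_left ψ h').imp_trans conj_imp_swap

theorem imp_conj_imp (φ ψ : Formula) : Derives L Γ (imp (conj (imp φ ψ) φ) ψ) :=
  conj_imp_iff.2 (imp_refl _)

theorem imp_imp_mono (h : Derives L Γ (imp ψ φ)) (h' : Derives L Γ (imp χ ξ)) :
    Derives L Γ (imp (imp φ χ) (imp ψ ξ)) :=
  conj_imp_iff.1 (((imp_refl _).imp_conj_mono h).imp_trans ((imp_conj_imp φ χ).imp_trans h'))

theorem conj_assoc_imp : Derives L Γ (imp (conj (conj φ ψ) χ) (conj φ (conj ψ χ))) :=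
  conj_imp_iff.2 <| conj_imp_iff.2 <|
    (conj_imp_iff.1 (imp_refl _)).imp_trans (.base (.a7b _ _ _))

theorem imp_conj_assoc : Derives L Γ (imp (conj φ (conj ψ χ)) (conj (conj φ ψ) χ)) :=
  conj_imp_iff.2 <| (conj_imp_iff.1 (conj_imp_iff.1 (imp_refl _))).imp_trans (.base (.a7a _ _ _))

theorem of_imp_imp (φ ψ : Formula) (h : Derives L Γ (imp (imp φ ψ) χ))
    (h' : Derives L Γ (imp (imp ψ φ) χ)) : Derives L Γ χ :=
  .mp h' (.mp h (.base (.a8 φ ψ χ)))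

theorem meet_imp_swap : Derives L Γ (imp (meet φ ψ) (meet ψ φ)) :=
  .base (.a5 φ ψ)

theorem meet_imp_left : Derives L Γ (imp (meet φ ψ) φ) :=
  .base (.a4 φ ψ)

theorem meet_imp_right : Derives L Γ (imp (meet φ ψ) ψ) :=
  meet_imp_swap.imp_trans meet_imp_left

theorem imp_conj_imp_meet (h : Derives L Γ (imp χ φ)) :
    Derives L Γ (imp (conj (imp φ ψ) χ) (meet ψ φ)) :=
  ((imp_refl _).imp_conj_mono h).imp_trans <| conj_imp_swap.imp_trans <| .base (.a6 φ ψ)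

theorem imp_meet (h : Derives L Γ (imp χ φ)) (h' : Derives L Γ (imp χ ψ)) :
    Derives L Γ (imp χ (meet φ ψ)) :=
  of_imp_imp φ ψ (conj_imp_iff.1 ((imp_conj_imp_meet h).imp_trans meet_imp_swap))
    (conj_imp_iff.1 (imp_conj_imp_meet h'))

end Derives

/-- Lattice disjunction, which is definable in MTL and interpreted by `⊔`. -/
def Formula.join (φ ψ : Formula) : Formula :=
  meet (imp (imp φ ψ) ψ) (imp (imp ψ φ) φ)

namespace Derives

variable {L : Extension} {Γ : Set Formula} {φ ψ χ : Formula}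

theorem imp_join_left : Derives L Γ (imp φ (join φ ψ)) :=
  imp_meet (exchange (imp_refl _)) (conj_imp_iff.1 conj_imp_left)

theorem imp_join_right : Derives L Γ (imp ψ (join φ ψ)) :=
  imp_meet (conj_imp_iff.1 conj_imp_left) (exchange (imp_refl _))

theorem join_imp (h : Derives L Γ (imp φ χ)) (h' : Derives L Γ (imp ψ χ)) :
    Derives L Γ (imp (join φ ψ) χ) :=
  of_imp_imp φ ψ (exchange (meet_imp_left.imp_trans (imp_imp_mono (imp_refl _) h')))
    (exchange (meet_imp_right.imp_trans (imp_imp_mono (imp_refl _) h)))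

end Derives

/-! ### Lindenbaum algebras -/

/-- Formulas preordered by derivability of the implication from `Γ`, lifted to an arbitrary
universe. -/
abbrev derivabilityPreorder (L : Extension) (Γ : Set Formula) : Preorder (ULift.{u} Formula) where
  le φ ψ := Derives L Γ (imp φ.down ψ.down)
  le_refl _ := .imp_refl _
  le_trans _ _ _ := .imp_trans

/-- The Lindenbaum algebra of the theory `Γ` in `L`: formulas modulo interderivability over `Γ`. -/
def Lindenbaum (L : Extension) (Γ : Set Formula) : Type u :=
  @Antisymmetrization (ULift.{u} Formula) (derivabilityPreorder L Γ).le inferInstance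

namespace Lindenbaum

variable {L : Extension} {Γ : Set Formula} {φ ψ : Formula}

instance : PartialOrder (Lindenbaum.{u} L Γ) :=
  @instPartialOrderAntisymmetrization _ (derivabilityPreorder L Γ)

/-- The class of a formula in the Lindenbaum algebra. -/
def mk (L : Extension) (Γ : Set Formula) (φ : Formula) : Lindenbaum.{u} L Γ :=
  @toAntisymmetrization _ (derivabilityPreorder L Γ).le inferInstance ⟨φ⟩

theorem mk_surjective : Function.Surjective (mk.{u} L Γ) := by
  rintro ⟨⟨φ⟩⟩
  exact ⟨φ, rfl⟩

theorem mk_le_mk : mk.{u} L Γ φ ≤ mk L Γ ψ ↔ Derives L Γ (imp φ ψ) :=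
  Iff.rfl

theorem mk_eq_mk : mk.{u} L Γ φ = mk L Γ ψ ↔ Derives L Γ (imp φ ψ) ∧ Derives L Γ (imp ψ φ) := by
  rw [le_antisymm_iff, mk_le_mk, mk_le_mk]

/-- The operation of the Lindenbaum algebra induced by a binary connective that respects
interderivability. -/
def map₂ (f : Formula → Formula → Formula)
    (hf : ∀ {φ ψ χ ξ}, Derives L Γ (imp φ ψ) → Derives L Γ (imp ψ φ) → Derives L Γ (imp χ ξ) →
      Derives L Γ (imp ξ χ) → Derives L Γ (imp (f φ χ) (f ψ ξ))) :
    Lindenbaum.{u} L Γ → Lindenbaum.{u} L Γ → Lindenbaum.{u} L Γ :=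
  Quotient.map₂ (fun φ ψ => ⟨f φ.down ψ.down⟩)
    fun _ _ h _ _ h' => ⟨hf h.1 h.2 h'.1 h'.2, hf h.2 h.1 h'.2 h'.1⟩

instance : Lattice (Lindenbaum.{u} L Γ) where
  inf := map₂ meet fun h _ h' _ =>
    .imp_meet (Derives.meet_imp_left.imp_trans h) (Derives.meet_imp_right.imp_trans h')
  sup := map₂ join fun h _ h' _ =>
    .join_imp (h.imp_trans .imp_join_left) (h'.imp_trans .imp_join_right)
  inf_le_left := mk_surjective.forall₂.2 fun _ _ => Derives.meet_imp_left
  inf_le_right := mk_surjective.forall₂.2 fun _ _ => Derives.meet_imp_right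
  le_inf := mk_surjective.forall₃.2 fun _ _ _ => Derives.imp_meet
  le_sup_left := mk_surjective.forall₂.2 fun _ _ => Derives.imp_join_left
  le_sup_right := mk_surjective.forall₂.2 fun _ _ => Derives.imp_join_right
  sup_le := mk_surjective.forall₃.2 fun _ _ _ => Derives.join_imp

instance : BoundedOrder (Lindenbaum.{u} L Γ) where
  top := mk L Γ Formula.top
  bot := mk L Γ bot
  le_top := mk_surjective.forall.2 fun _ => Derives.top.imp_of_derives
  bot_le := mk_surjective.forall.2 fun _ => Derives.bot_imp

instance : CommMonoid (Lindenbaum.{u} L Γ) where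
  mul := map₂ conj fun h _ h' _ => .imp_conj_mono h h'
  one := mk L Γ Formula.top
  mul_assoc := mk_surjective.forall₃.2 fun _ _ _ =>
    mk_eq_mk.2 ⟨.conj_assoc_imp, .imp_conj_assoc⟩
  one_mul := mk_surjective.forall.2 fun _ => mk_eq_mk.2
    ⟨Derives.conj_imp_swap.imp_trans .conj_imp_left,
      .mp .top (Derives.conj_imp_iff.1 (.imp_refl _))⟩
  mul_one := mk_surjective.forall.2 fun _ => mk_eq_mk.2
    ⟨.conj_imp_left, .mp .top (.exchange (Derives.conj_imp_iff.1 (.imp_refl _)))⟩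
  mul_comm := mk_surjective.forall₂.2 fun _ _ => mk_eq_mk.2 ⟨.conj_imp_swap, .conj_imp_swap⟩

instance : HImp (Lindenbaum.{u} L Γ) where
  himp := map₂ imp fun _ h h' _ => .imp_imp_mono h h'

theorem mk_eq_one : mk.{u} L Γ φ = 1 ↔ Derives L Γ φ :=
  (mk_eq_mk (ψ := Formula.top)).trans
    ⟨fun h => .mp .top h.2, fun h => ⟨Derives.top.imp_of_derives, h.imp_of_derives⟩⟩

instance : MTLAlgebra (Lindenbaum.{u} L Γ) where
  top_eq_one := rfl
  residuation := mk_surjective.forall₃.2 fun _ _ _ => Derives.conj_imp_iff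
  prelinearity := mk_surjective.forall₂.2 fun φ ψ =>
    mk_eq_one.2 (.of_imp_imp φ ψ .imp_join_left .imp_join_right)

theorem eval_mk (σ : ℕ → Formula) (φ : Formula) :
    eval (fun i => mk.{u} L Γ (σ i)) φ = mk L Γ (φ.subst σ) := by
  induction φ with
  | var i => rfl
  | bot => rfl
  | conj φ ψ h h' => rw [eval, h, h']; rfl
  | meet φ ψ h h' => rw [eval, h, h']; rfl
  | imp φ ψ h h' => rw [eval, h, h']; rfl

theorem valid_iff : Valid (Lindenbaum.{u} L Γ) φ ↔ ∀ σ : ℕ → Formula, Derives L Γ (φ.subst σ) := by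
  simp only [Valid, mk_surjective.comp_left.forall, Function.comp_def, eval_mk, mk_eq_one]

theorem isAlgebraOf : IsAlgebraOf L (Lindenbaum.{u} L Γ) :=
  fun _ hφ => valid_iff.2 fun σ => .scheme σ hφ

theorem completeWrt_empty : CompleteWrt L (Lindenbaum.{u} L ∅) :=
  isAlgebraOf.completeWrt fun φ h => subst_var φ ▸ valid_iff.1 h var

theorem rel_one_of_derives (θ : Congruence (Lindenbaum.{u} L Γ)) (h : Derives L Γ φ) :
    θ.r (mk L Γ φ) 1 :=
  mk_eq_one.2 h ▸ θ.iseqv.refl _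

theorem rel_one_of_derives_setOf_rel_one {θ : Congruence (Lindenbaum.{u} L Γ)}
    (h : Derives L {ψ | θ.r (mk L Γ ψ) 1} φ) : θ.r (mk L Γ φ) 1 := by
  induction h with
  | hyp h => exact h
  | base h => exact rel_one_of_derives θ (.base h)
  | scheme σ h => exact rel_one_of_derives θ (.scheme σ h)
  | mp _ _ h h' => exact θ.rel_one_of_rel_himp_one h h'

theorem subdirectlyIrreducible_of_maximal (hΓ : Maximal (fun Δ => ¬ Derives L Δ φ) Γ) :
    SubdirectlyIrreducible (Lindenbaum.{u} L Γ) := by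
  refine .of_forall_rel_one (a := mk L Γ φ) (mt mk_eq_one.1 hΓ.prop) fun θ hθ => ?_
  refine rel_one_of_derives_setOf_rel_one (not_not.1 fun hφ => ?_)
  have hsub : Γ ⊆ {ψ | θ.r (mk L Γ ψ) 1} := fun _ hψ => rel_one_of_derives θ (.hyp hψ)
  obtain ⟨z, hz, hz1⟩ := hθ.exists_rel_one
  obtain ⟨ψ, rfl⟩ := mk_surjective z
  exact hz (mk_eq_one.2 (.hyp (hΓ.le_of_ge hφ hsub hz1)))

end Lindenbaum

theorem IsGeneric.isAlgebraOf {L : Extension} {A : Type u} [MTLAlgebra A] (hA : IsGeneric L A) :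
    IsAlgebraOf L A :=
  (hA A).1 fun _ _ => id

theorem isGeneric_iff_completeWrt {L : Extension} {A : Type u} [MTLAlgebra A] :
    IsGeneric L A ↔ CompleteWrt L A := by
  refine ⟨fun hA => hA.isAlgebraOf.completeWrt fun φ hφ => ?_, fun hA B _ => ⟨fun h φ hφ => ?_,
    fun hB φ ψ hφψ => ?_⟩⟩
  · exact (Lindenbaum.completeWrt_empty φ).2 <| satisfiesIdentity_top_iff.1 <|
      (hA (Lindenbaum.{u} L ∅)).2 Lindenbaum.isAlgebraOf φ _ (satisfiesIdentity_top_iff.2 hφ)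
  · exact satisfiesIdentity_top_iff.1 (h φ _ (satisfiesIdentity_top_iff.2 (hA.isAlgebraOf φ hφ)))
  · rw [satisfiesIdentity_iff_valid_imp, ← hA, ← hA] at hφψ
    exact satisfiesIdentity_iff_valid_imp.2 (hφψ.imp (·.valid hB) (·.valid hB))

/-! ### Copies of formulas in disjoint variables -/

namespace Formula

/-- A Gödel numbering, witnessing that there are countably many formulas. -/
def code : Formula → ℕ
  | var i => Nat.pair 0 i
  | bot => Nat.pair 1 0
  | conj φ ψ => Nat.pair 2 (Nat.pair φ.code ψ.code)
  | meet φ ψ => Nat.pair 3 (Nat.pair φ.code ψ.code)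
  | imp φ ψ => Nat.pair 4 (Nat.pair φ.code ψ.code)

theorem code_injective : Function.Injective code := by
  intro φ
  induction φ <;> rintro ⟨⟩ <;> grind [code, Nat.pair_eq_pair]

instance : Countable Formula :=
  code_injective.countable

instance : Nonempty Formula :=
  ⟨bot⟩

/-- A partition of the variables into one spare variable, the image of `none`, and a separate
sequence of variables for every formula. -/
noncomputable def varEquiv : Option (Formula × ℕ) ≃ ℕ :=
  Classical.choice nonempty_equiv_of_countable

/-- The variable that belongs to none of the formulas in the partition `varEquiv`. -/
noncomputable def spareVar : Formula :=
  var (varEquiv none)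

/-- The copy of `φ` in the variables that `varEquiv` reserves for `φ`. -/
noncomputable def freshCopy (φ : Formula) : Formula :=
  φ.subst fun i => var (varEquiv (some (φ, i)))

end Formula

/-- The assignment that acts on the variables reserved for `φ` as `E φ` does on all variables, and
takes the value `c` at the spare variable. -/
noncomputable def jointAssignment {A : Type u} (c : A) (E : Formula → ℕ → A) (i : ℕ) : A :=
  (varEquiv.symm i).elim c fun p => E p.1 p.2

section JointAssignment

variable {A : Type u} [MTLAlgebra A] {L : Extension} (c : A) (E : Formula → ℕ → A)

theorem eval_jointAssignment_spareVar : eval (jointAssignment c E) spareVar = c := by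
  simp only [spareVar, eval, jointAssignment, Equiv.symm_apply_apply, Option.elim_none]

theorem eval_jointAssignment_freshCopy (φ : Formula) :
    eval (jointAssignment c E) φ.freshCopy = eval (E φ) φ := by
  simp only [freshCopy, eval_subst, eval, jointAssignment, Equiv.symm_apply_apply,
    Option.elim_some]

theorem CompleteWrt.exists_forall_eval_ne_one (hA : CompleteWrt L A) :
    ∃ E : Formula → ℕ → A, ∀ φ, ¬ Provable L φ → eval (E φ) φ ≠ 1 := by
  refine Classical.axiom_of_choice (r := fun φ e => ¬ Provable L φ → eval e φ ≠ 1) fun φ => ?_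
  by_contra! h
  exact (h 1).1 ((hA φ).2 fun e => (h e).2)

theorem Lindenbaum.completeWrt_of_forall_freshCopy {Γ : Set Formula}
    (hΓ : ∀ φ, Derives L Γ φ.freshCopy → Provable L φ) : CompleteWrt L (Lindenbaum.{u} L Γ) :=
  isAlgebraOf.completeWrt fun φ hφ => hΓ φ (valid_iff.1 hφ _)

end JointAssignment

/-! ### Single chain completeness -/

section Chains

variable {A : Type u} [MTLAlgebra A] {L : Extension}

theorem derives_setOf_eval_eq_one_iff (hA : IsAlgebraOf L A) (e : ℕ → A) {φ : Formula} :
    Derives L {ψ | eval e ψ = 1} φ ↔ eval e φ = 1 :=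
  ⟨fun h => h.eval_eq_one hA fun _ => id, fun h => .hyp h⟩

theorem Lindenbaum.isChain_setOf_eval_eq_one (hA : IsChain A) (e : ℕ → A) :
    IsChain (Lindenbaum.{v} L {ψ | eval e ψ = 1}) :=
  mk_surjective.forall₂.2 fun φ ψ => (hA (eval e φ) (eval e ψ)).imp
    (fun h => mk_le_mk.2 (.hyp (himp_eq_one_iff.2 h)))
    (fun h => mk_le_mk.2 (.hyp (himp_eq_one_iff.2 h)))

theorem SCC.change_universe (h : SCC.{u} L) : SCC.{v} L := by
  obtain ⟨A, _, hAL, hchain, hA⟩ := h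
  obtain ⟨E, hE⟩ := hA.exists_forall_eval_ne_one
  refine ⟨Lindenbaum L {ψ | eval (jointAssignment 1 E) ψ = 1}, inferInstance,
    Lindenbaum.isAlgebraOf, Lindenbaum.isChain_setOf_eval_eq_one hchain _,
    Lindenbaum.completeWrt_of_forall_freshCopy fun φ hφ => ?_⟩
  rw [derives_setOf_eval_eq_one_iff hAL, eval_jointAssignment_freshCopy] at hφ
  exact not_not.1 fun h => hE φ h hφ

/-- The theory that bounds the fresh copies of all unprovable formulas by the spare variable, so
that they all fail wherever the spare variable does. -/
def separatingTheory (L : Extension) : Set Formula :=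
  (fun φ => imp φ.freshCopy spareVar) '' {φ | ¬ Provable L φ}

theorem not_derives_separatingTheory_spareVar [Nontrivial A] (hchain : IsChain A)
    (hA : CompleteWrt L A) : ¬ Derives L (separatingTheory L) spareVar := by
  intro h
  obtain ⟨S, hSL, hS, hSp⟩ := h.exists_finite_subset
  obtain ⟨F, hF, hFfin, rfl⟩ := Set.exists_subset_image_finite_and.1 ⟨S, hSL, hS, rfl⟩
  obtain ⟨E, hE⟩ := hA.exists_forall_eval_ne_one
  set c := hFfin.toFinset.sup fun φ => eval (E φ) φ
  have hc : c ≠ 1 := hchain.finset_sup_ne_one fun _ hφ => hE _ (hF (hFfin.mem_toFinset.1 hφ))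
  have hmodel : ∀ ψ ∈ (fun φ => imp φ.freshCopy spareVar) '' F,
      eval (jointAssignment c E) ψ = 1 := by
    rintro _ ⟨φ, hφ, rfl⟩
    rw [eval, himp_eq_one_iff, eval_jointAssignment_freshCopy, eval_jointAssignment_spareVar]
    exact Finset.le_sup (f := fun φ => eval (E φ) φ) (hFfin.mem_toFinset.2 hφ)
  exact hc (eval_jointAssignment_spareVar c E ▸ hSp.eval_eq_one hA.isAlgebraOf hmodel)

theorem Lindenbaum.completeWrt_of_separatingTheory_subset {Γ : Set Formula}
    (hΓ : separatingTheory L ⊆ Γ) (h : ¬ Derives L Γ spareVar) :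
    CompleteWrt L (Lindenbaum.{u} L Γ) :=
  completeWrt_of_forall_freshCopy fun _ hφ => not_not.1 fun hL =>
    h (.mp hφ (.hyp (hΓ (Set.mem_image_of_mem _ hL))))

theorem Lindenbaum.subsingleton_of_completeWrt [Subsingleton A] (hA : CompleteWrt L A)
    (Γ : Set Formula) : Subsingleton (Lindenbaum.{v} L Γ) := by
  have hprovable (φ : Formula) : Provable L φ := (hA φ).2 fun _ => Subsingleton.elim _ _
  refine ⟨mk_surjective.forall₂.2 fun φ ψ => ?_⟩
  exact mk_eq_mk.2 ⟨(hprovable _).mono Γ.empty_subset, (hprovable _).mono Γ.empty_subset⟩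

end Chains

theorem SCC.subSCC {L : Extension} (h : SCC.{u} L) : SubSCC.{v} L := by
  obtain ⟨A, _, -, hchain, hA⟩ := h
  suffices ∃ Γ, SubdirectlyIrreducible (Lindenbaum.{v} L Γ) ∧ CompleteWrt L (Lindenbaum.{v} L Γ) by
    obtain ⟨Γ, hirr, hΓ⟩ := this
    exact ⟨_, _, Lindenbaum.isAlgebraOf, hirr, isGeneric_iff_completeWrt.2 hΓ⟩
  rcases subsingleton_or_nontrivial A with _ | _
  · exact ⟨∅, .inl (Lindenbaum.subsingleton_of_completeWrt hA ∅), Lindenbaum.completeWrt_empty⟩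
  · obtain ⟨Γ, hΓ, hmax⟩ := Derives.exists_maximal_not_derives
      (not_derives_separatingTheory_spareVar hchain hA)
    exact ⟨Γ, Lindenbaum.subdirectlyIrreducible_of_maximal hmax,
      Lindenbaum.completeWrt_of_separatingTheory_subset hΓ hmax.prop⟩

theorem SubSCC.scc {L : Extension} (h : SubSCC.{u} L) : SCC.{u} L := by
  obtain ⟨A, _, hAL, hirr, hgen⟩ := h
  exact ⟨A, _, hAL, hirr.isChain, isGeneric_iff_completeWrt.1 hgen⟩

end MTL

theorem mainTheorem3_general (L : MTL.Extension) : MTL.SCC.{u} L ↔ MTL.SubSCC.{v} L :=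
  ⟨MTL.SCC.subSCC, fun h => h.scc.change_universe⟩

theorem mainTheorem3 (L : MTL.Extension) (n : ℕ) (hn : 0 < n) (hL : MTL.Contractive L n) :
    MTL.SCC.{u} L ↔ MTL.SubSCC.{v} L :=
  mainTheorem3_general L
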